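/- Let $G$ be a finite simple graph and $S \subseteq V(G)$. A vertex totally dominates exactly its neighbours. In the total domination game on $G|S$, the vertices of $S$ are declared to be already totally dominated; two players, Dominator and Staller, alternately choose vertices of $G$, Dominator moving first, where each chosen vertex must totally dominate at least one vertex that is not yet totally dominated (i.e. that is neither in $S$ nor adjacent to a previously chosen vertex). The game ends when no such vertex exists. Dominator wants to minimize, and Staller to maximize, the number of vertices chosen; $\gamma_{\rm tg}(G|S)$ denotes this number when both players play optimally. Write $\gamma_{\rm tg}(G) = \gamma_{\rm tg}(G|\emptyset)$ and $\gamma_{\rm tg}(G|v) = \gamma_{\rm tg}(G|\{v\})$. The graph $G$ is called $\gamma_{\rm tg}$-critical if $\gamma_{\rm tg}(G|v) < \gamma_{\rm tg}(G)$ for every vertex $v$ of $G$. **Theorem.** Let $n \ge 2$ be an integer and let $P_n$ be the path on $n$ vertices. Then $P_n$ is $\gamma_{\rm tg}$-critical if and only if $n \equiv 2 \pmod 6$ or $n \equiv 4 \pmod 6$. -/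

import Mathlib

namespace TotalDominationGame

/-- The two players of the total domination game. -/
inductive Player where
  | dominator
  | staller

/-- The player whose turn comes next. -/
def Player.other : Player → Player
  | .dominator => .staller
  | .staller => .dominator

variable {V : Type*} [Fintype V] [DecidableEq V]

/-- The legal moves in `G` when exactly the vertices of `A` are already totally dominated: the
vertices `u` that totally dominate (are adjacent to) at least one vertex outside `A`. A vertex that
was chosen before is never legal again, since all of its neighbours are then in `A`. -/
def legalMoves (G : SimpleGraph V) [DecidableRel G.Adj] (A : Finset V) : Finset V :=
  Finset.univ.filter fun u => ∃ w, G.Adj u w ∧ w ∉ A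

/-- The set of totally dominated vertices after the vertex `u` is chosen. -/
def play (G : SimpleGraph V) [DecidableRel G.Adj] (A : Finset V) (u : V) : Finset V :=
  A ∪ G.neighborFinset u

theorem card_compl_play_lt (G : SimpleGraph V) [DecidableRel G.Adj] {A : Finset V} {u : V}
    (hu : u ∈ legalMoves G A) : ((play G A u)ᶜ).card < (Aᶜ).card := by
  obtain ⟨w, hw, hA⟩ := (Finset.mem_filter.mp hu).2
  apply Finset.card_lt_card
  rw [Finset.compl_ssubset_compl]
  refine ⟨Finset.subset_union_left, fun h => hA (h ?_)⟩
  exact Finset.mem_union_right _ ((G.mem_neighborFinset u w).mpr hw)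

/-- The number of moves in the rest of the game on `G` under optimal play, when exactly the vertices
of `A` are already totally dominated and it is `p`'s turn. The game ends when there is no legal
move; otherwise the player to move chooses a legal move, Dominator minimizing and Staller maximizing
the number of moves. -/
def movesLeft (G : SimpleGraph V) [DecidableRel G.Adj] (p : Player) (A : Finset V) : ℕ :=
  if h : (legalMoves G A).Nonempty then
    match p with
    | .dominator => 1 + (legalMoves G A).attach.inf' (Finset.attach_nonempty_iff.mpr h)
        fun u => movesLeft G Player.dominator.other (play G A u.1)
    | .staller => 1 + (legalMoves G A).attach.sup' (Finset.attach_nonempty_iff.mpr h)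
        fun u => movesLeft G Player.staller.other (play G A u.1)
  else 0
termination_by (Aᶜ).card
decreasing_by all_goals exact card_compl_play_lt G u.2

/-- `γ_tg(G|S)`: the number of moves in the game started by Dominator on the partially total
dominated graph `G|S`, in which the vertices of `S` are declared to be already totally dominated. -/
def gameTotalDominationNumberOn (G : SimpleGraph V) [DecidableRel G.Adj] (S : Finset V) : ℕ :=
  movesLeft G .dominator S

/-- The game total domination number `γ_tg(G)`. -/
def gameTotalDominationNumber (G : SimpleGraph V) [DecidableRel G.Adj] : ℕ :=
  gameTotalDominationNumberOn G ∅

/-- `G` is total domination game critical: `γ_tg(G|v) < γ_tg(G)` for every vertex `v`. -/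
def IsCritical (G : SimpleGraph V) [DecidableRel G.Adj] : Prop :=
  ∀ v : V, gameTotalDominationNumberOn G {v} < gameTotalDominationNumber G

instance (n : ℕ) : DecidableRel (SimpleGraph.pathGraph n).Adj := fun _ _ =>
  decidable_of_iff' _ SimpleGraph.pathGraph_adj

end TotalDominationGame

/-! Choosing a vertex of the path dominates its two neighbours, which are at distance two. Padded
with one covered cell beyond each end, the path splits by parity into two strips, on which each move
covers two consecutive cells.

Give a run of `m` uncovered cells the weight `f m = m + ⌈m/3⌉`, and let `Φ` be the total weight.
Each move lowers `Φ` by 1, 2 or 3. Dominator can take at least 2, and 3 when `Φ` is odd; Staller can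
hold the drop to at most 2, and to 1 when `Φ` is odd, given a mild condition on strip 1. Hence the
game started by Dominator lasts `⌊Φ/2⌋` moves (`movesLeft_dominator_le_pathWeight`,
`pathWeight_le_movesLeft_dominator`).

Initially the runs have lengths `⌊n/2⌋` and `⌈n/2⌉`, and predominating a vertex splits one of them.
If `n` is 2 or 4 mod 6, both have the same length `m`, not divisible by 3; then `Φ` is even and
every split lowers it. Otherwise some split leaves `⌊Φ/2⌋` unchanged. -/

namespace TotalDominationGame

/-! ### Bounding the length of the game by a potential. -/

section Potential

variable {V : Type*} [Fintype V] [DecidableEq V] (G : SimpleGraph V) [DecidableRel G.Adj]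

theorem mem_legalMoves {A : Finset V} {u : V} :
    u ∈ legalMoves G A ↔ ∃ w, G.Adj u w ∧ w ∉ A := by
  simp [legalMoves]

theorem movesLeft_eq_zero (p : Player) {A : Finset V} (h : ¬ (legalMoves G A).Nonempty) :
    movesLeft G p A = 0 := by
  rw [movesLeft, dif_neg h]

theorem movesLeft_dominator_le {A : Finset V} {u : V} (hu : u ∈ legalMoves G A) :
    movesLeft G .dominator A ≤ 1 + movesLeft G .staller (play G A u) := by
  rw [movesLeft, dif_pos ⟨u, hu⟩]
  exact Nat.add_le_add_left (Finset.inf'_le (f := fun u : {x // x ∈ legalMoves G A} =>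
    movesLeft G Player.dominator.other (play G A u.1)) (Finset.mem_attach _ ⟨u, hu⟩)) 1

theorem le_movesLeft_staller {A : Finset V} {u : V} (hu : u ∈ legalMoves G A) :
    1 + movesLeft G .dominator (play G A u) ≤ movesLeft G .staller A := by
  rw [movesLeft.eq_1 G .staller A, dif_pos ⟨u, hu⟩]
  exact Nat.add_le_add_left (Finset.le_sup' (f := fun u : {x // x ∈ legalMoves G A} =>
    movesLeft G Player.staller.other (play G A u.1)) (Finset.mem_attach _ ⟨u, hu⟩)) 1

theorem exists_movesLeft_dominator {A : Finset V} (h : (legalMoves G A).Nonempty) :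
    ∃ u ∈ legalMoves G A,
      movesLeft G .dominator A = 1 + movesLeft G .staller (play G A u) := by
  rw [movesLeft, dif_pos h]
  obtain ⟨u, -, hu⟩ := Finset.exists_mem_eq_inf' (Finset.attach_nonempty_iff.mpr h)
    (fun u : {x // x ∈ legalMoves G A} => movesLeft G Player.dominator.other (play G A u.1))
  exact ⟨u.1, u.2, congrArg (1 + ·) hu⟩

theorem exists_movesLeft_staller {A : Finset V} (h : (legalMoves G A).Nonempty) :
    ∃ u ∈ legalMoves G A,
      movesLeft G .staller A = 1 + movesLeft G .dominator (play G A u) := by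
  rw [movesLeft, dif_pos h]
  obtain ⟨u, -, hu⟩ := Finset.exists_mem_eq_sup' (Finset.attach_nonempty_iff.mpr h)
    (fun u : {x // x ∈ legalMoves G A} => movesLeft G Player.staller.other (play G A u.1))
  exact ⟨u.1, u.2, congrArg (1 + ·) hu⟩

/-- Upper bound on the length of the game from a potential that every move decreases and that
Dominator can decrease by two, and by three when it is odd. -/
theorem movesLeft_le_of_potential (Φ : Finset V → ℕ)
    (hlt : ∀ A, ∀ u ∈ legalMoves G A, Φ (play G A u) < Φ A)
    (htwo : ∀ A, 0 < Φ A → ∃ u ∈ legalMoves G A, Φ (play G A u) + 2 ≤ Φ A)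
    (hthree : ∀ A, Φ A % 2 = 1 → ∃ u ∈ legalMoves G A, Φ (play G A u) + 3 ≤ Φ A)
    (A : Finset V) :
    movesLeft G .dominator A ≤ Φ A / 2 ∧ movesLeft G .staller A ≤ (Φ A + 1) / 2 := by
  induction h : Φ A using Nat.strong_induction_on generalizing A with
  | _ k ih =>
    subst h
    by_cases hne : (legalMoves G A).Nonempty
    · constructor
      · rcases Nat.mod_two_eq_zero_or_one (Φ A) with hp | hp
        · obtain ⟨v, hv⟩ := hne
          obtain ⟨u, hu, hd⟩ := htwo A ((Nat.zero_le _).trans_lt (hlt A v hv))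
          have h1 := movesLeft_dominator_le G hu
          have h2 := (ih _ (hlt A u hu) _ rfl).2
          omega
        -- A drop of only two would leave Staller an odd potential, where rounding up costs one move
        -- too many.
        · obtain ⟨u, hu, hd⟩ := hthree A hp
          have h1 := movesLeft_dominator_le G hu
          have h2 := (ih _ (hlt A u hu) _ rfl).2
          omega
      · obtain ⟨u, hu, he⟩ := exists_movesLeft_staller G hne
        have h1 := hlt A u hu
        have h2 := (ih _ h1 _ rfl).1
        omega
    · simp [movesLeft_eq_zero G _ hne]

/-- Lower bound on the length of the game from a potential that no move decreases by more than
three and that, in positions satisfying `P`, Staller can decrease by at most two, and by exactly one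
when it is odd. -/
theorem le_movesLeft_of_potential (Φ : Finset V → ℕ) (P : Finset V → Prop)
    (hP : ∀ A u, P A → P (play G A u))
    (hlt : ∀ A, ∀ u ∈ legalMoves G A, Φ (play G A u) < Φ A)
    (hthree : ∀ A, ∀ u ∈ legalMoves G A, Φ A ≤ Φ (play G A u) + 3)
    (htwo : ∀ A, P A → 0 < Φ A → ∃ u ∈ legalMoves G A, Φ A ≤ Φ (play G A u) + 2)
    (hone : ∀ A, P A → Φ A % 2 = 1 → ∃ u ∈ legalMoves G A, Φ A ≤ Φ (play G A u) + 1)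
    (A : Finset V) (hA : P A) :
    Φ A / 2 ≤ movesLeft G .dominator A ∧ (Φ A + 1) / 2 ≤ movesLeft G .staller A := by
  induction h : Φ A using Nat.strong_induction_on generalizing A with
  | _ k ih =>
    subst h
    rcases Nat.eq_zero_or_pos (Φ A) with h0 | h0
    · simp [h0]
    · constructor
      · obtain ⟨v, hv, -⟩ := htwo A hA h0
        obtain ⟨u, hu, he⟩ := exists_movesLeft_dominator G ⟨v, hv⟩
        have h1 := hthree A u hu
        have h2 := (ih _ (hlt A u hu) _ (hP A u hA) rfl).2
        omega
      · rcases Nat.mod_two_eq_zero_or_one (Φ A) with hp | hp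
        · obtain ⟨u, hu, hd⟩ := htwo A hA h0
          have h1 := le_movesLeft_staller G hu
          have h2 := (ih _ (hlt A u hu) _ (hP A u hA) rfl).1
          omega
        · obtain ⟨u, hu, hd⟩ := hone A hA hp
          have h1 := le_movesLeft_staller G hu
          have h2 := (ih _ (hlt A u hu) _ (hP A u hA) rfl).1
          omega

end Potential

/-! ### Covering two consecutive cells of a strip -/

/-- The weight of a strip of cells (`true` for a cell that is still to be covered) preceded by `s`
uncovered cells (`s` taken modulo three): in each run of uncovered cells the first, fourth, seventh,
… cell weighs two and the others weigh one. -/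
def weight : ℕ → List Bool → ℕ
  | _, [] => 0
  | _, false :: l => weight 0 l
  | 0, true :: l => weight 1 l + 2
  | 1, true :: l => weight 2 l + 1
  | _ + 2, true :: l => weight 0 l + 1

/-- Cover the cells number `i` and `i + 1`. -/
def cover (i : ℕ) (l : List Bool) : List Bool :=
  (l.set i false).set (i + 1) false

@[simp] theorem cover_zero (a b : Bool) (l : List Bool) :
    cover 0 (a :: b :: l) = false :: false :: l := rfl

@[simp] theorem cover_succ (i : ℕ) (a : Bool) (l : List Bool) :
    cover (i + 1) (a :: l) = a :: cover i l := rfl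

/-- Covering cells shifts the phase at which the rest of a run is counted; this bounds the effect of
such a shift by one. -/
theorem weight_phase (l : List Bool) :
    weight 1 l ≤ weight 2 l ∧ weight 2 l ≤ weight 0 l ∧ weight 0 l ≤ weight 1 l + 1 := by
  induction l with
  | nil => simp [weight]
  | cons b l ih => cases b <;> simp only [weight] <;> omega

theorem weight_cover_bounds (i : ℕ) (l : List Bool)
    (h : l[i]? = some true ∨ l[i + 1]? = some true) (hi : i + 1 < l.length) (s : ℕ) :
    weight s (cover i l) < weight s l ∧ weight s l ≤ weight s (cover i l) + 3 := by
  induction l generalizing i s with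
  | nil => simp at hi
  | cons a l ih =>
    cases i with
    | zero =>
      cases l with
      | nil => simp at hi
      | cons b l =>
        have := weight_phase l
        rcases s with _ | _ | s <;> cases a <;> cases b <;> simp [weight] at h ⊢ <;> omega
    | succ i =>
      have ih' := ih i (by simpa using h) (by simpa using hi)
      have h0 := ih' 0
      have h1 := ih' 1
      have h2 := ih' 2
      rcases s with _ | _ | s <;> cases a <;> simp only [cover_succ, weight] <;> omega

theorem exists_cover_two : ∀ l : List Bool, 2 ≤ l.length → 0 < weight 0 l →
    ∃ i, i + 1 < l.length ∧ weight 0 (cover i l) + 2 ≤ weight 0 l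
  | [], h, _ => by simp at h
  | [_], h, _ => by simp at h
  | false :: [true], _, _ => ⟨0, by simp [weight]⟩
  | false :: [false], _, h => by simp [weight] at h
  | false :: b :: c :: l, _, h => by
    obtain ⟨i, hi, h'⟩ := exists_cover_two (b :: c :: l) (by simp) h
    exact ⟨i + 1, by simpa using hi, h'⟩
  | true :: false :: l, _, _ => ⟨0, by simp [weight]⟩
  | true :: true :: l, _, _ => ⟨0, by simp, by
    have := weight_phase l
    simp only [cover_zero, weight]
    omega⟩

/-- Three consecutive cells of a run weigh 4, so a run has odd weight exactly when its length is 2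
mod 3. An odd total forces such a run, and covering its last two cells removes 3. -/
theorem exists_cover_three : ∀ l : List Bool, weight 0 l % 2 = 1 →
    ∃ i, i + 1 < l.length ∧ weight 0 (cover i l) + 3 ≤ weight 0 l
  | [], h => by simp [weight] at h
  | [true], h => by simp [weight] at h
  | false :: l, h => by
    obtain ⟨i, hi, h'⟩ := exists_cover_three l h
    exact ⟨i + 1, by simpa using hi, h'⟩
  | true :: false :: l, h => by
    obtain ⟨i, hi, h'⟩ := exists_cover_three l (by simp only [weight] at h; omega)
    exact ⟨i + 2, by simp only [List.length_cons] at hi ⊢; omega,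
      by simp only [cover_succ, weight]; omega⟩
  | [true, true], _ => ⟨0, by simp [weight]⟩
  | true :: true :: false :: l, _ => ⟨0, by simp [weight]⟩
  | true :: true :: true :: l, h => by
    obtain ⟨i, hi, h'⟩ := exists_cover_three l (by simp only [weight] at h; omega)
    exact ⟨i + 3, by simp only [List.length_cons] at hi ⊢; omega,
      by simp only [cover_succ, weight]; omega⟩

theorem weight_replicate_append (r : List Bool) : ∀ m : ℕ,
    weight 0 (List.replicate m true ++ false :: r) = m + (m + 2) / 3 + weight 0 r
  | 0 => by simp [weight]
  | 1 => by simp [weight]; omega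
  | 2 => by simp [weight]; omega
  | m + 3 => by
    have := weight_replicate_append r m
    simp only [List.replicate_succ, List.cons_append, weight, this]
    omega

theorem weight_replicate : ∀ m : ℕ, weight 0 (List.replicate m true) = m + (m + 2) / 3
  | 0 => by simp [weight]
  | 1 => by simp [weight]
  | 2 => by simp [weight]
  | m + 3 => by
    have := weight_replicate m
    simp only [List.replicate_succ, weight, this]
    omega

/-- Shortening a run of length 2 mod 3 by one end cell removes weight 1. The second cell of the move
must then already be covered, so a strip consisting of a single full run has to be excluded. -/
theorem exists_cover_one : ∀ l : List Bool, false ∈ l → weight 0 l % 2 = 1 →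
    ∃ i, i + 1 < l.length ∧ weight 0 l = weight 0 (cover i l) + 1
  | [], h, _ => by simp at h
  | [true], h, _ => by simp at h
  | [true, true], h, _ => by simp at h
  | false :: l, _, h => by
    by_cases hl : false ∈ l
    · obtain ⟨i, hi, h'⟩ := exists_cover_one l hl h
      exact ⟨i + 1, by simpa using hi, h'⟩
    · obtain ⟨m, rfl⟩ : ∃ m, l = List.replicate m true :=
        ⟨l.length, List.eq_replicate_of_mem fun b hb => by cases b <;> simp_all⟩
      have hm : weight 0 (List.replicate m true) % 2 = 1 := h
      rw [weight_replicate] at hm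
      obtain ⟨k, rfl⟩ : ∃ k, m = k + 1 := ⟨m - 1, by omega⟩
      refine ⟨0, by simp, ?_⟩
      have h1 := weight_replicate (k + 1)
      have h2 := weight_replicate k
      rw [List.replicate_succ] at h1 ⊢
      simp only [cover_zero, weight] at h1 ⊢
      omega
  | true :: false :: l, _, h => by
    obtain ⟨i, hi, h'⟩ := exists_cover_one (false :: l) (by simp)
      (by simp only [weight] at h ⊢; omega)
    -- The head stays covered, so the phase before it is irrelevant.
    have h'' : weight 1 (cover i (false :: l)) = weight 0 (cover i (false :: l)) := by
      cases i <;> cases l <;> simp [cover, weight]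
    refine ⟨i + 1, by simpa using hi, ?_⟩
    simp only [cover_succ, weight] at h' ⊢
    omega
  | true :: true :: false :: l, _, _ => ⟨1, by simp [weight]⟩
  | true :: true :: true :: l, hl, h => by
    obtain ⟨i, hi, h'⟩ := exists_cover_one l (by simpa using hl)
      (by simp only [weight] at h; omega)
    exact ⟨i + 3, by simp only [List.length_cons] at hi ⊢; omega,
      by simp only [cover_succ, weight]; omega⟩

/-- No covered cell is needed here: the full strip `[true, true]`, whose only move removes 3, is
ruled out by parity, and a longer full run can be cut so as to lose only 2. -/
theorem exists_cover_le_two : ∀ l : List Bool, 2 ≤ l.length → 0 < weight 0 l →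
    weight 0 l % 2 = 0 → ∃ i, i + 1 < l.length ∧ weight 0 (cover i l) < weight 0 l ∧
      weight 0 l ≤ weight 0 (cover i l) + 2
  | [], h, _, _ => by simp at h
  | [_], h, _, _ => by simp at h
  | false :: [true], _, _, _ => ⟨0, by simp [weight]⟩
  | false :: [false], _, h, _ => by simp [weight] at h
  | false :: b :: c :: l, _, h, h2 => by
    obtain ⟨i, hi, h'⟩ := exists_cover_le_two (b :: c :: l) (by simp) h h2
    exact ⟨i + 1, by simpa using hi, h'⟩
  | true :: false :: l, _, _, _ => ⟨0, by simp [weight]⟩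
  | [true, true], _, _, h => by simp [weight] at h
  | true :: true :: false :: l, _, _, _ => ⟨1, by simp [weight]⟩
  | [true, true, true], _, _, _ => ⟨0, by simp [weight]⟩
  | [true, true, true, true], _, _, _ => ⟨1, by simp [weight]⟩
  | true :: true :: true :: false :: l, _, _, _ => ⟨2, by simp [weight]⟩
  | true :: true :: true :: true :: b :: l, _, _, h2 => by
    obtain ⟨i, hi, h', h''⟩ := exists_cover_le_two (true :: b :: l) (by simp)
      (by simp [weight]) (by simp only [weight] at h2 ⊢; omega)
    refine ⟨i + 3, by simpa using hi, ?_⟩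
    rw [cover_succ, cover_succ, cover_succ]
    generalize cover i (true :: b :: l) = l' at *
    simp only [weight] at h' h'' ⊢
    omega

theorem weight_replicate_false (r : List Bool) (t : ℕ) :
    weight 0 (List.replicate t false ++ r) = weight 0 r := by
  induction t with
  | zero => rfl
  | succ t ih => simpa [List.replicate_succ, weight] using ih

theorem weight_run (t m t' : ℕ) :
    weight 0 (List.replicate t false ++ (List.replicate m true ++ List.replicate t' false)) =
      m + (m + 2) / 3 := by
  rw [weight_replicate_false]
  cases t' with
  | zero => simpa using weight_replicate m
  | succ t' =>
    rw [List.replicate_succ, weight_replicate_append]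
    simpa [weight] using weight_replicate_false [] t'

/-! ### The path as two strips -/

/-- The state of the vertices of the path, the `i`-th one placed at position `i + 1`; all other
positions count as covered. -/
def cell {n : ℕ} (A : Finset (Fin n)) (j : ℕ) : Bool :=
  decide (∃ v : Fin n, v.1 + 1 = j ∧ v ∉ A)

/-- The strip formed by the positions `e`, `e + 2`, `e + 4`, … up to `n + 1`. -/
def strip {n : ℕ} (A : Finset (Fin n)) (e : ℕ) : List Bool :=
  (List.range ((n + 3 - e) / 2)).map fun i => cell A (2 * i + e)

/-- The weight of a position of the game on the path. -/
def pathWeight {n : ℕ} (A : Finset (Fin n)) : ℕ :=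
  weight 0 (strip A 0) + weight 0 (strip A 1)

open SimpleGraph

variable {n : ℕ}

theorem length_strip (A : Finset (Fin n)) (e : ℕ) : (strip A e).length = (n + 3 - e) / 2 := by
  simp [strip]

theorem cell_play (A : Finset (Fin n)) (u : Fin n) (j : ℕ) :
    cell (play (pathGraph n) A u) j = (cell A j && j != u.1 && j != u.1 + 2) := by
  rw [Bool.eq_iff_iff]
  simp only [cell, play, Finset.mem_union, mem_neighborFinset, pathGraph_adj, decide_eq_true_eq,
    Bool.and_eq_true, bne_iff_ne]
  constructor
  · rintro ⟨v, rfl, hv⟩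
    exact ⟨⟨⟨v, rfl, fun h => hv (Or.inl h)⟩, fun h => hv (Or.inr (Or.inr h))⟩,
      fun h => hv (Or.inr (Or.inl (by omega)))⟩
  · rintro ⟨⟨⟨v, rfl, hv⟩, h1⟩, h2⟩
    refine ⟨v, rfl, ?_⟩
    rintro (h | h | h)
    · exact hv h
    · omega
    · omega

theorem mem_legalMoves_iff (A : Finset (Fin n)) (u : Fin n) :
    u ∈ legalMoves (pathGraph n) A ↔ cell A u.1 = true ∨ cell A (u.1 + 2) = true := by
  simp only [legalMoves, Finset.mem_filter, Finset.mem_univ, true_and, pathGraph_adj, cell,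
    decide_eq_true_eq]
  constructor
  · rintro ⟨w, h | h, hw⟩
    · exact Or.inr ⟨w, by omega, hw⟩
    · exact Or.inl ⟨w, h, hw⟩
  · rintro (⟨w, h, hw⟩ | ⟨w, h, hw⟩)
    · exact ⟨w, Or.inr h, hw⟩
    · exact ⟨w, Or.inl (by omega), hw⟩

theorem strip_play_self (A : Finset (Fin n)) (u : Fin n) :
    strip (play (pathGraph n) A u) (u.1 % 2) = cover (u.1 / 2) (strip A (u.1 % 2)) := by
  apply List.ext_getElem
  · simp [cover, strip]
  · intro i h1 h2
    simp only [strip, cover, List.getElem_map, List.getElem_range, List.getElem_set, cell_play]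
    split_ifs with h h'
    · simp [show 2 * i + u.1 % 2 = u.1 + 2 by omega]
    · simp [show 2 * i + u.1 % 2 = u.1 by omega]
    · have h3 : 2 * i + u.1 % 2 ≠ u.1 := by omega
      have h4 : 2 * i + u.1 % 2 ≠ u.1 + 2 := by omega
      simp [bne_iff_ne.mpr h3, bne_iff_ne.mpr h4]

theorem strip_play_other (A : Finset (Fin n)) (u : Fin n) {e : ℕ} (he : e % 2 ≠ u.1 % 2) :
    strip (play (pathGraph n) A u) e = strip A e := by
  apply List.map_congr_left
  intro i _
  have h3 : 2 * i + e ≠ u.1 := by omega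
  have h4 : 2 * i + e ≠ u.1 + 2 := by omega
  rw [cell_play, bne_iff_ne.mpr h3, bne_iff_ne.mpr h4, Bool.and_true, Bool.and_true]

theorem pathWeight_play_bounds (A : Finset (Fin n)) (u : Fin n)
    (hu : u ∈ legalMoves (pathGraph n) A) :
    pathWeight (play (pathGraph n) A u) < pathWeight A ∧
      pathWeight A ≤ pathWeight (play (pathGraph n) A u) + 3 := by
  have hun := u.2
  have key := weight_cover_bounds (u.1 / 2) (strip A (u.1 % 2)) (by
    rw [mem_legalMoves_iff] at hu
    have h1 : u.1 / 2 + 1 < (n + 3 - u.1 % 2) / 2 := by omega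
    simpa [strip, List.getElem?_range h1, List.getElem?_range ((Nat.lt_succ_self _).trans h1),
      show 2 * (u.1 / 2) + u.1 % 2 = u.1 by omega,
      show 2 * (u.1 / 2 + 1) + u.1 % 2 = u.1 + 2 by omega] using hu)
    (by rw [length_strip]; omega) 0
  rw [← strip_play_self] at key
  unfold pathWeight
  rcases Nat.mod_two_eq_zero_or_one u.1 with h | h <;> rw [h] at key
  · rw [strip_play_other A u (e := 1) (by omega)]
    omega
  · rw [strip_play_other A u (e := 0) (by omega)]
    omega

/-- Covering two consecutive cells of one of the strips is a move of the game. -/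
theorem exists_move_of_cover (A : Finset (Fin n)) {e i : ℕ} (he : e < 2)
    (hi : i + 1 < (strip A e).length)
    (hlt : weight 0 (cover i (strip A e)) < weight 0 (strip A e)) :
    ∃ u ∈ legalMoves (pathGraph n) A, pathWeight (play (pathGraph n) A u) +
      weight 0 (strip A e) = pathWeight A + weight 0 (cover i (strip A e)) := by
  rw [length_strip] at hi
  let u : Fin n := ⟨2 * i + e, by omega⟩
  have h1 : u.1 % 2 = e := by simp only [u]; omega
  have h2 : u.1 / 2 = i := by simp only [u]; omega
  have hs := strip_play_self A u
  rw [h1, h2] at hs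
  refine ⟨u, ?_, ?_⟩
  -- An illegal choice changes nothing, contradicting the strict drop in weight.
  · by_contra hu
    have hA : play (pathGraph n) A u = A := by
      refine Finset.union_eq_left.mpr fun w hw => ?_
      by_contra hwA
      exact hu ((mem_legalMoves _).mpr ⟨w, (mem_neighborFinset _ _ _).mp hw, hwA⟩)
    rw [hA] at hs
    rw [← hs] at hlt
    exact lt_irrefl _ hlt
  · unfold pathWeight
    rcases (show e = 0 ∨ e = 1 by omega) with rfl | rfl
    · rw [strip_play_other A u (e := 1) (by omega), hs]
      omega
    · rw [strip_play_other A u (e := 0) (by omega), hs]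
      omega

theorem movesLeft_dominator_le_pathWeight (hn : 2 ≤ n) (A : Finset (Fin n)) :
    movesLeft (pathGraph n) .dominator A ≤ pathWeight A / 2 := by
  refine (movesLeft_le_of_potential (pathGraph n) pathWeight
    (fun A u hu => (pathWeight_play_bounds A u hu).1) (fun A hA => ?_) (fun A hA => ?_) A).1
  · obtain ⟨e, he, hpos⟩ : ∃ e < 2, 0 < weight 0 (strip A e) := by
      unfold pathWeight at hA
      by_cases h : 0 < weight 0 (strip A 0)
      · exact ⟨0, by omega, h⟩
      · exact ⟨1, by omega, by omega⟩
    obtain ⟨i, hi, h⟩ := exists_cover_two _ (by rw [length_strip]; omega) hpos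
    obtain ⟨u, hu, h'⟩ := exists_move_of_cover A he hi (by omega)
    exact ⟨u, hu, by omega⟩
  · obtain ⟨e, he, hodd⟩ : ∃ e < 2, weight 0 (strip A e) % 2 = 1 := by
      unfold pathWeight at hA
      by_cases h : weight 0 (strip A 0) % 2 = 1
      · exact ⟨0, by omega, h⟩
      · exact ⟨1, by omega, by omega⟩
    obtain ⟨i, hi, h⟩ := exists_cover_three _ hodd
    obtain ⟨u, hu, h'⟩ := exists_move_of_cover A he hi (by omega)
    exact ⟨u, hu, by omega⟩

theorem false_mem_strip_zero (A : Finset (Fin n)) : false ∈ strip A 0 :=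
  List.mem_map.mpr ⟨0, by simp, by simp [cell]⟩

/-- Strip 0 always contains the covered cell 0, but for odd `n` strip 1 has no padding. The
hypothesis gives Staller a move of drop 1 whenever strip 1 is odd; it persists because any move on
strip 1 creates a covered cell. -/
theorem pathWeight_le_movesLeft_dominator (hn : 2 ≤ n) (A : Finset (Fin n))
    (hA : false ∈ strip A 1 ∨ weight 0 (strip A 1) % 2 = 0) :
    pathWeight A / 2 ≤ movesLeft (pathGraph n) .dominator A := by
  refine (le_movesLeft_of_potential (pathGraph n) pathWeight
    (fun A => false ∈ strip A 1 ∨ weight 0 (strip A 1) % 2 = 0) (fun A u h => ?_)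
    (fun A u hu => (pathWeight_play_bounds A u hu).1)
    (fun A u hu => (pathWeight_play_bounds A u hu).2)
    (fun A hP hA => ?_) (fun A hP hA => ?_) A hA).1
  · rcases Nat.mod_two_eq_zero_or_one u.1 with hu | hu
    · rwa [strip_play_other A u (by omega)]
    · left
      have := u.2
      refine List.mem_map.mpr ⟨u.1 / 2, List.mem_range.mpr (by omega), ?_⟩
      simp [cell_play, show 2 * (u.1 / 2) + 1 = u.1 by omega]
  · by_cases h0 : weight 0 (strip A 0) % 2 = 1
    · obtain ⟨i, hi, h⟩ := exists_cover_one _ (false_mem_strip_zero A) h0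
      obtain ⟨u, hu, h'⟩ := exists_move_of_cover A (by omega) hi (by omega)
      exact ⟨u, hu, by omega⟩
    by_cases h1 : weight 0 (strip A 1) % 2 = 1
    · obtain ⟨i, hi, h⟩ := exists_cover_one _ (hP.resolve_right (by omega)) h1
      obtain ⟨u, hu, h'⟩ := exists_move_of_cover A (by omega) hi (by omega)
      exact ⟨u, hu, by omega⟩
    obtain ⟨e, he, heven, hpos⟩ : ∃ e < 2, weight 0 (strip A e) % 2 = 0 ∧
        0 < weight 0 (strip A e) := by
      unfold pathWeight at hA
      by_cases h : 0 < weight 0 (strip A 0)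
      · exact ⟨0, by omega, by omega, h⟩
      · exact ⟨1, by omega, by omega, by omega⟩
    obtain ⟨i, hi, h, h2⟩ := exists_cover_le_two _ (by rw [length_strip]; omega) hpos heven
    obtain ⟨u, hu, h'⟩ := exists_move_of_cover A he hi h
    exact ⟨u, hu, by omega⟩
  · obtain ⟨e, he, hodd, hmem⟩ : ∃ e < 2, weight 0 (strip A e) % 2 = 1 ∧
        false ∈ strip A e := by
      unfold pathWeight at hA
      by_cases h : weight 0 (strip A 0) % 2 = 1
      · exact ⟨0, by omega, h, false_mem_strip_zero A⟩
      · exact ⟨1, by omega, by omega, hP.resolve_right (by omega)⟩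
    obtain ⟨i, hi, h⟩ := exists_cover_one _ hmem hodd
    obtain ⟨u, hu, h'⟩ := exists_move_of_cover A he hi (by omega)
    exact ⟨u, hu, by omega⟩

/-! ### Weights of the starting positions. -/

theorem cell_empty (j : ℕ) : cell (∅ : Finset (Fin n)) j = decide (1 ≤ j ∧ j ≤ n) := by
  rw [Bool.eq_iff_iff]
  simp only [cell, Finset.notMem_empty, not_false_eq_true, and_true, decide_eq_true_eq]
  constructor
  · rintro ⟨v, rfl⟩
    have := v.2
    omega
  · rintro ⟨h1, h2⟩
    exact ⟨⟨j - 1, by omega⟩, by simp only; omega⟩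

theorem cell_singleton (v : Fin n) (j : ℕ) :
    cell {v} j = decide (1 ≤ j ∧ j ≤ n ∧ j ≠ v.1 + 1) := by
  rw [Bool.eq_iff_iff]
  simp only [cell, Finset.mem_singleton, decide_eq_true_eq]
  constructor
  · rintro ⟨w, rfl, h⟩
    have := w.2
    exact ⟨by omega, by omega, fun h' => h (Fin.ext (by omega))⟩
  · rintro ⟨h1, h2, h3⟩
    exact ⟨⟨j - 1, by omega⟩, by simp only; omega,
      fun h => h3 (by rw [← h]; simp only; omega)⟩

theorem strip_empty {e : ℕ} (he : e < 2) : strip (∅ : Finset (Fin n)) e =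
    List.replicate (1 - e) false ++ (List.replicate ((n + e) / 2) true ++
      List.replicate ((n + 3 - e) / 2 - (1 - e) - (n + e) / 2) false) := by
  apply List.ext_getElem
  · simp only [length_strip, List.length_append, List.length_replicate]
    omega
  · intro i h1 h2
    rw [length_strip] at h1
    simp only [strip, List.getElem_map, List.getElem_range, cell_empty, List.getElem_append,
      List.getElem_replicate, List.length_replicate]
    split_ifs with h h' <;> simp only [decide_eq_true_eq, decide_eq_false_iff_not] <;> omega

theorem weight_strip_empty {e : ℕ} (he : e < 2) : weight 0 (strip (∅ : Finset (Fin n)) e) =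
    (n + e) / 2 + ((n + e) / 2 + 2) / 3 := by
  rw [strip_empty he, weight_run]

theorem strip_singleton_of_ne (v : Fin n) {e : ℕ} (he : e % 2 = v.1 % 2) :
    strip {v} e = strip (∅ : Finset (Fin n)) e := by
  apply List.map_congr_left
  intro i _
  rw [cell_singleton, cell_empty]
  congr 1
  simp only [ne_eq, eq_iff_iff]
  omega

theorem strip_singleton (v : Fin n) {e : ℕ} (he : e < 2) (hv : e % 2 ≠ v.1 % 2) :
    strip {v} e = List.replicate (1 - e) false ++ (List.replicate ((v.1 + e - 1) / 2) true ++
      -- The empty block gives the tail the shape required by `weight_run`.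
      false :: (List.replicate 0 false ++
        (List.replicate ((n + e) / 2 - (v.1 + e - 1) / 2 - 1) true ++
          List.replicate ((n + 3 - e) / 2 - (1 - e) - (n + e) / 2) false))) := by
  have hvn := v.2
  apply List.ext_getElem
  · simp only [length_strip, List.length_append, List.length_replicate, List.length_cons]
    omega
  · intro i h1 h2
    rw [length_strip] at h1
    simp only [strip, List.getElem_map, List.getElem_range, cell_singleton, List.getElem_append,
      List.getElem_replicate, List.length_replicate, List.getElem_cons]
    split_ifs <;> simp only [decide_eq_true_eq, decide_eq_false_iff_not] <;> omega

theorem weight_strip_singleton (v : Fin n) {e : ℕ} (he : e < 2) (hv : e % 2 ≠ v.1 % 2) :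
    weight 0 (strip {v} e) = (v.1 + e - 1) / 2 + ((v.1 + e - 1) / 2 + 2) / 3 +
      (((n + e) / 2 - (v.1 + e - 1) / 2 - 1) +
        ((n + e) / 2 - (v.1 + e - 1) / 2 - 1 + 2) / 3) := by
  rw [strip_singleton v he hv, weight_replicate_false, weight_replicate_append, weight_run]

/-- For `m` not divisible by 3 and `a + b = m - 1`, one has `⌈a/3⌉ + ⌈b/3⌉ ≤ ⌈m/3⌉`, so splitting
the run loses at least 1 from an even total. -/
theorem pathWeight_singleton_lt (h : n % 6 = 2 ∨ n % 6 = 4) (v : Fin n) :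
    pathWeight {v} / 2 < pathWeight (∅ : Finset (Fin n)) / 2 := by
  have hvn := v.2
  unfold pathWeight
  rw [weight_strip_empty (by omega), weight_strip_empty (by omega)]
  rcases Nat.mod_two_eq_zero_or_one v.1 with hv | hv
  · rw [strip_singleton_of_ne v (e := 0) (by omega), weight_strip_empty (by omega),
      weight_strip_singleton v (e := 1) (by omega) (by omega)]
    omega
  · rw [strip_singleton_of_ne v (e := 1) (by omega), weight_strip_empty (by omega),
      weight_strip_singleton v (e := 0) (by omega) (by omega)]
    omega

theorem exists_pathWeight_le_singleton (hn : 2 ≤ n) (h : ¬ (n % 6 = 2 ∨ n % 6 = 4)) :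
    ∃ v : Fin n, (false ∈ strip {v} 1 ∨ weight 0 (strip {v} 1) % 2 = 0) ∧
      pathWeight (∅ : Finset (Fin n)) / 2 ≤ pathWeight {v} / 2 := by
  unfold pathWeight
  rw [weight_strip_empty (by omega), weight_strip_empty (by omega)]
  have mem_one : ∀ v : Fin n, v.1 % 2 = 0 → false ∈ strip {v} 1 := fun v hv => by
    have := v.2
    exact List.mem_map.mpr ⟨v.1 / 2, List.mem_range.mpr (by omega), by
      rw [cell_singleton]
      simp only [decide_eq_false_iff_not]
      omega⟩
  by_cases h1 : n % 6 = 1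
  -- The run of strip 0 has length `3k`; marking its second cell leaves runs of lengths 1 and `3k -
  -- 2`, of the same total weight `4k`. Strip 1, of run length `3k + 1`, has even weight.
  · let v : Fin n := ⟨3, by omega⟩
    have hv : v.1 = 3 := rfl
    refine ⟨v, ?_, ?_⟩
    · rw [strip_singleton_of_ne v (by omega), weight_strip_empty (by omega)]
      omega
    · rw [strip_singleton_of_ne v (e := 1) (by omega), weight_strip_empty (by omega),
        weight_strip_singleton v (e := 0) (by omega) (by omega)]
      omega
  -- For `n` divisible by 6, the second cell of strip 1 again costs nothing. For `n` equal to 3 or 5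
  -- mod 6, an end cell of strip 1 costs 1, which halving the odd total absorbs.
  · let v : Fin n := ⟨if n % 6 = 0 then 2 else 0, by split_ifs <;> omega⟩
    have hv : n % 6 = 0 ∧ v.1 = 2 ∨ n % 6 ≠ 0 ∧ v.1 = 0 := by
      simp only [v]
      split_ifs <;> omega
    refine ⟨v, Or.inl (mem_one v (by omega)), ?_⟩
    rw [strip_singleton_of_ne v (e := 0) (by omega), weight_strip_empty (by omega),
      weight_strip_singleton v (e := 1) (by omega) (by omega)]
    omega

end TotalDominationGame

theorem theoremt (n : ℕ) (hn : 2 ≤ n) :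
    TotalDominationGame.IsCritical (SimpleGraph.pathGraph n) ↔ n % 6 = 2 ∨ n % 6 = 4 := by
  open TotalDominationGame in
  constructor
  · intro hc
    by_contra h
    obtain ⟨v, hv, hle⟩ := exists_pathWeight_le_singleton hn h
    exact absurd (hc v) (not_lt.mpr ((movesLeft_dominator_le_pathWeight hn ∅).trans
      (hle.trans (pathWeight_le_movesLeft_dominator hn {v} hv))))
  · intro h v
    refine (movesLeft_dominator_le_pathWeight hn {v}).trans_lt
      ((pathWeight_singleton_lt h v).trans_le (pathWeight_le_movesLeft_dominator hn ∅ ?_))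
    left
    refine List.mem_map.mpr ⟨n / 2, List.mem_range.mpr (by omega), ?_⟩
    rw [cell_empty]
    simp only [decide_eq_false_iff_not]
    omega
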